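/- Let $n\ge 1$ and $p\ge 0$ be integers, $\beta\in\mathbb{R}^p$, $\sigma>0$, $\epsilon\in[0,1]$, and let $(Q_x)_{x\in\mathbb{R}^p}$ be an arbitrary Markov kernel from $\mathbb{R}^p$ to $\mathbb{R}$ (a family of probability distributions on $\mathbb{R}$ depending measurably on $x$). In the adaptive contamination model, the pairs $(X_1,y_1),\dots,(X_n,y_n)\in\mathbb{R}^p\times\mathbb{R}$ are independent and identically distributed with $$X_i\sim\mathcal{N}(0,I_p),\qquad y_i\mid X_i\sim(1-\epsilon)\,\mathcal{N}(X_i^\top\beta,\sigma^2)+\epsilon\,Q_{X_i}.$$ A median ($\ell_1$) regression estimator is any $$\widehat\beta\in\mathop{\mathrm{arg\,min}}_{b\in\mathbb{R}^p}\frac1n\sum_{i=1}^n|y_i-X_i^\top b|.$$ Theorem 4.2. For every $\alpha\in(0,1)$ there exist constants $C,c>0$, depending only on $\alpha$, such that for all $n,p,\beta,\sigma,\epsilon,(Q_x)$ as above with $\sqrt{p/n}+\epsilon\le c$, with probability at least $1-\alpha$ the above minimum is attained and every minimizer $\widehat\beta$ satisfies $$\|\widehat\beta-\beta\|_2\le C\sigma\left(\sqrt{\frac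 pn}+\epsilon\right).$$ -/

import Mathlib

open MeasureTheory ProbabilityTheory

/-- The contaminated conditional law of the response given the covariate `x`:
`(1 - ε) N(xᵀβ, σ²) + ε Q_x`, as a kernel from covariates to responses. -/
noncomputable def contaminatedResponse {p : ℕ} (β : EuclideanSpace ℝ (Fin p)) (σ ε : ℝ)
    (Q : Kernel (EuclideanSpace ℝ (Fin p)) ℝ) : Kernel (EuclideanSpace ℝ (Fin p)) ℝ where
  toFun x := ENNReal.ofReal (1 - ε) • gaussianReal (inner ℝ x β) (σ ^ 2).toNNReal
    + ENNReal.ofReal ε • Q x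
  measurable' := by
    have hG : Measurable fun x : EuclideanSpace ℝ (Fin p) =>
        gaussianReal (inner ℝ x β) (σ ^ 2).toNNReal :=
      measurable_gaussianReal.comp
        (f := fun x : EuclideanSpace ℝ (Fin p) => (inner ℝ x β, (σ ^ 2).toNNReal)) (by fun_prop)
    refine Measure.measurable_of_measurable_coe _ fun s hs => ?_
    simp only [Measure.add_apply, Measure.smul_apply, smul_eq_mul]
    exact (((Measure.measurable_coe hs).comp hG).const_mul _).add
      ((Q.measurable_coe hs).const_mul _)

/-- For `0 ≤ ε ≤ 1` the mixture is a probability law for every covariate. -/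
theorem isMarkovKernel_contaminatedResponse {p : ℕ} (β : EuclideanSpace ℝ (Fin p)) (σ ε : ℝ)
    (hε0 : 0 ≤ ε) (hε1 : ε ≤ 1) (Q : Kernel (EuclideanSpace ℝ (Fin p)) ℝ) [IsMarkovKernel Q] :
    IsMarkovKernel (contaminatedResponse β σ ε Q) := by
  refine ⟨fun x => ⟨?_⟩⟩
  change (ENNReal.ofReal (1 - ε) • gaussianReal (inner ℝ x β) (σ ^ 2).toNNReal
    + ENNReal.ofReal ε • Q x) Set.univ = 1
  simp only [Measure.add_apply, Measure.smul_apply, smul_eq_mul, measure_univ, mul_one]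
  rw [← ENNReal.ofReal_add (by linarith) hε0]
  simp

/-- The law of one pair `(X, y)` under adaptive contamination in the response:
`X ∼ N(0, I_p)` and `y ∣ X ∼ (1 - ε) N(Xᵀβ, σ²) + ε Q_X`. -/
noncomputable def adaptiveLaw {p : ℕ} (β : EuclideanSpace ℝ (Fin p)) (σ ε : ℝ)
    (Q : Kernel (EuclideanSpace ℝ (Fin p)) ℝ) : Measure (EuclideanSpace ℝ (Fin p) × ℝ) :=
  (stdGaussian (EuclideanSpace ℝ (Fin p))) ⊗ₘ (contaminatedResponse β σ ε Q)

/-- The law of `n` independent pairs `(X₁, y₁), …, (Xₙ, yₙ)`, each with law `adaptiveLaw`. -/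
noncomputable def adaptiveSampleLaw {p : ℕ} (n : ℕ) (β : EuclideanSpace ℝ (Fin p)) (σ ε : ℝ)
    (Q : Kernel (EuclideanSpace ℝ (Fin p)) ℝ) :
    Measure (Fin n → EuclideanSpace ℝ (Fin p) × ℝ) :=
  Measure.pi fun _ => adaptiveLaw β σ ε Q

/-- For `0 ≤ ε ≤ 1` the sample law is a probability measure. -/
theorem isProbabilityMeasure_adaptiveSampleLaw {p : ℕ} (n : ℕ) (β : EuclideanSpace ℝ (Fin p))
    (σ ε : ℝ) (hε0 : 0 ≤ ε) (hε1 : ε ≤ 1) (Q : Kernel (EuclideanSpace ℝ (Fin p)) ℝ)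
    [IsMarkovKernel Q] : IsProbabilityMeasure (adaptiveSampleLaw n β σ ε Q) := by
  have := isMarkovKernel_contaminatedResponse β σ ε hε0 hε1 Q
  unfold adaptiveSampleLaw adaptiveLaw
  infer_instance

/-- The empirical absolute loss `(1/n) ∑ᵢ |yᵢ - Xᵢᵀ b|` of the data `d i = (Xᵢ, yᵢ)`. -/
noncomputable def absLoss {n p : ℕ} (d : Fin n → EuclideanSpace ℝ (Fin p) × ℝ)
    (b : EuclideanSpace ℝ (Fin p)) : ℝ :=
  (1 / (n : ℝ)) * ∑ i, |(d i).2 - inner ℝ (d i).1 b|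

/-- `b` is a median regression estimate for the data `d`: a global minimizer over `ℝᵖ` of the
empirical absolute loss. -/
def IsMedianRegression {n p : ℕ} (d : Fin n → EuclideanSpace ℝ (Fin p) × ℝ)
    (b : EuclideanSpace ℝ (Fin p)) : Prop :=
  ∀ b' : EuclideanSpace ℝ (Fin p), absLoss d b ≤ absLoss d b'

/-! The empirical loss is convex, so it is enough that on a sphere of radius `t` about `β` it
exceeds its value at the centre: all minimizers then lie in the ball (`medianRegression_localized`).

On average this holds (`le_integral_excessLoss`). Write `κ` for `gaussianAbsMean`. Clean data raise
the loss by `κ * (√(σ² + t²) - σ)`, at least `κ * t² / (3σ)` when `t ≤ σ`; a contaminated response,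
however extreme, lowers it by at most `|Xᵀδ|`, which costs `ε * κ * t` in the mean.

The excess loss is 1-Lipschitz in `Xᵀδ` whatever `y` is, so symmetrization and contraction bound the
expected largest downward deviation of the sum by `2 * t * √(n * p)`. Markov's inequality turns this
into `2 * t * √(p/n) / α` for the average, outside an event of probability `α`. The quadratic gain
beats both linear losses once `t` is a large multiple of `σ * (√(p/n) + ε)`. Suprema are taken over
finite families and extended to the sphere by density and continuity. -/

/-! ### Rademacher averages and contraction -/

section Rademacher

variable {ι τ : Type*} [Fintype ι]

/-- The largest signed coordinate sum over a finite family of vectors. -/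
noncomputable def signedSup (T : Finset τ) (hT : T.Nonempty) (a : τ → ι → ℝ) (s : ι → ℤˣ) : ℝ :=
  T.sup' hT fun t => ∑ i, ((s i : ℤ) : ℝ) * a t i

variable [DecidableEq ι]

/-- Averages over sign vectors are invariant under flipping one sign. -/
theorem sum_sign_flip (i : ι) (g : (ι → ℤˣ) → ℝ) :
    ∑ s, g (Function.update s i (-s i)) = ∑ s, g s := by
  have hinv : Function.Involutive fun s : ι → ℤˣ => Function.update s i (-s i) := by
    intro s
    ext j
    by_cases h : j = i
    · subst h; simp
    · simp [h]
  exact Equiv.sum_comp hinv.toPerm g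

/-- Each flip pair is counted twice on both sides, so a comparison that fails pointwise may still be
checked pair by pair. -/
theorem sum_sign_le_of_flip (i : ι) {g h : (ι → ℤˣ) → ℝ}
    (H : ∀ s, g s + g (Function.update s i (-s i)) ≤ h s + h (Function.update s i (-s i))) :
    ∑ s, g s ≤ ∑ s, h s := by
  have := Finset.sum_le_sum fun s (_ : s ∈ Finset.univ) => H s
  rw [Finset.sum_add_distrib, Finset.sum_add_distrib, sum_sign_flip, sum_sign_flip] at this
  linarith

theorem sum_sign_flip_split (i : ι) (s : ι → ℤˣ) (a : ι → ℝ) :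
    ∑ j, ((s j : ℤ) : ℝ) * a j = ((s i : ℤ) : ℝ) * a i
      + ∑ j ∈ Finset.univ.erase i, ((s j : ℤ) : ℝ) * a j := by
  rw [Finset.add_sum_erase _ (fun j => ((s j : ℤ) : ℝ) * a j) (Finset.mem_univ i)]

theorem sum_erase_flip (i : ι) (s : ι → ℤˣ) (a : ι → ℝ) :
    ∑ j ∈ Finset.univ.erase i, ((Function.update s i (-s i) j : ℤ) : ℝ) * a j
      = ∑ j ∈ Finset.univ.erase i, ((s j : ℤ) : ℝ) * a j := by
  refine Finset.sum_congr rfl fun j hj => ?_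
  rw [Function.update_of_ne (Finset.ne_of_mem_erase hj)]

/-- Contracting a single coordinate decreases the Rademacher average. -/
theorem sum_signedSup_le_of_coordinate (T : Finset τ) (hT : T.Nonempty) (i : ι)
    {a b : τ → ι → ℝ} (hab : ∀ t, ∀ j, j ≠ i → a t j = b t j)
    (hi : ∀ t u, |a t i - a u i| ≤ |b t i - b u i|) :
    ∑ s, signedSup T hT a s ≤ ∑ s, signedSup T hT b s := by
  refine sum_sign_le_of_flip i fun s => ?_
  have hmax : ∀ s' : ι → ℤˣ, ∃ v ∈ T, signedSup T hT a s' = ∑ j, ((s' j : ℤ) : ℝ) * a v j :=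
    fun s' => Finset.exists_mem_eq_sup' hT _
  obtain ⟨t, ht, hteq⟩ := hmax s
  obtain ⟨u, hu, hueq⟩ := hmax (Function.update s i (-s i))
  have hle : ∀ (v : τ), v ∈ T → ∀ s' : ι → ℤˣ,
      ∑ j, ((s' j : ℤ) : ℝ) * b v j ≤ signedSup T hT b s' := fun v hv s' =>
    Finset.le_sup' (fun t => ∑ j, ((s' j : ℤ) : ℝ) * b t j) hv
  -- The maximizers for the two signs are tested on `b` both straight (`h1`, `h2`) and crossed
  -- (`h3`, `h4`). Whichever pairing contributes `+|b t i - b u i|` dominates the left side.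
  have h1 := hle t ht s
  have h2 := hle u hu (Function.update s i (-s i))
  have h3 := hle u hu s
  have h4 := hle t ht (Function.update s i (-s i))
  have herase : ∀ v, ∑ j ∈ Finset.univ.erase i, ((s j : ℤ) : ℝ) * a v j
      = ∑ j ∈ Finset.univ.erase i, ((s j : ℤ) : ℝ) * b v j := fun v =>
    Finset.sum_congr rfl fun j hj => by rw [hab v j (Finset.ne_of_mem_erase hj)]
  simp only [sum_sign_flip_split i, sum_erase_flip, Function.update_self] at h1 h2 h3 h4
  simp only [sum_sign_flip_split i, sum_erase_flip, Function.update_self, herase] at hteq hueq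
  rw [hteq, hueq]
  have hb := abs_le.1 (hi t u)
  rcases Int.units_eq_one_or (s i) with hs | hs <;> simp only [hs] at * <;> push_cast at * <;>
    rcases abs_cases (b t i - b u i) with ⟨hc, -⟩ | ⟨hc, -⟩ <;> rw [hc] at hb <;>
    linarith [hb.1, hb.2]

/-- Contraction principle for Rademacher averages over a finite family. -/
theorem sum_signedSup_le_of_contraction (T : Finset τ) (hT : T.Nonempty)
    {a b : τ → ι → ℝ} (h : ∀ i t u, |a t i - a u i| ≤ |b t i - b u i|) :
    ∑ s, signedSup T hT a s ≤ ∑ s, signedSup T hT b s := by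
  have key : ∀ J : Finset ι,
      ∑ s, signedSup T hT (fun t i => if i ∈ J then a t i else b t i) s
        ≤ ∑ s, signedSup T hT b s := by
    intro J
    induction J using Finset.induction_on with
    | empty => simp
    | insert i J hiJ ih =>
      refine le_trans (sum_signedSup_le_of_coordinate T hT i ?_ ?_) ih
      · intro t j hj
        simp [Finset.mem_insert, hj]
      · intro t u
        simpa [hiJ] using h i t u
  simpa using key Finset.univ

/-- Rademacher sums of vectors are orthogonal on average. -/
theorem sum_norm_sq_sign_smul {E : Type*} [NormedAddCommGroup E] [InnerProductSpace ℝ E]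
    (x : ι → E) :
    ∑ s : ι → ℤˣ, ‖∑ i, ((s i : ℤ) : ℝ) • x i‖ ^ 2
      = Fintype.card (ι → ℤˣ) * ∑ i, ‖x i‖ ^ 2 := by
  have key : ∀ J : Finset ι, ∑ s : ι → ℤˣ, ‖∑ i ∈ J, ((s i : ℤ) : ℝ) • x i‖ ^ 2
      = Fintype.card (ι → ℤˣ) * ∑ i ∈ J, ‖x i‖ ^ 2 := by
    intro J
    induction J using Finset.induction_on with
    | empty => simp
    | insert i J hiJ ih =>
      have hflip := sum_sign_flip i
        fun s : ι → ℤˣ => ‖∑ j ∈ insert i J, ((s j : ℤ) : ℝ) • x j‖ ^ 2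
      -- Flipping the new sign exchanges `S + x i` and `S - x i`; the parallelogram law removes the
      -- cross term.
      have hpt : ∀ s : ι → ℤˣ, ‖∑ j ∈ insert i J, ((s j : ℤ) : ℝ) • x j‖ ^ 2
          + ‖∑ j ∈ insert i J, ((Function.update s i (-s i) j : ℤ) : ℝ) • x j‖ ^ 2
          = 2 * ‖∑ j ∈ J, ((s j : ℤ) : ℝ) • x j‖ ^ 2 + 2 * ‖x i‖ ^ 2 := by
        intro s
        rw [Finset.sum_insert hiJ, Finset.sum_insert hiJ]
        have : ∑ j ∈ J, ((Function.update s i (-s i) j : ℤ) : ℝ) • x j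
            = ∑ j ∈ J, ((s j : ℤ) : ℝ) • x j :=
          Finset.sum_congr rfl fun j hj => by
            rw [Function.update_of_ne (by rintro rfl; exact hiJ hj)]
        rw [this]
        set S := ∑ j ∈ J, ((s j : ℤ) : ℝ) • x j
        have hp := parallelogram_law_with_norm ℝ S (x i)
        rcases Int.units_eq_one_or (s i) with hs | hs <;> simp [hs] <;>
          rw [add_comm (x i) S, neg_add_eq_sub] <;> nlinarith
      have hsum := Finset.sum_congr rfl fun s (_ : s ∈ Finset.univ) => hpt s
      rw [Finset.sum_add_distrib, Finset.sum_add_distrib, ← Finset.mul_sum, ih, hflip] at hsum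
      rw [Finset.sum_insert hiJ]
      simp only [Finset.sum_const, Finset.card_univ, nsmul_eq_mul] at hsum
      linarith
  exact key Finset.univ

end Rademacher

/-! ### Symmetrization and uniform deviations -/

section Symmetrization

variable {ι τ Ω : Type*} [Fintype ι] [MeasurableSpace Ω]

theorem integrable_finset_sup' {μ : Measure Ω} (T : Finset τ) (hT : T.Nonempty)
    {f : τ → Ω → ℝ} (hf : ∀ t ∈ T, Integrable (f t) μ) :
    Integrable (fun ω => T.sup' hT fun t => f t ω) μ := by
  have h : Integrable (T.sup' hT f) μ :=
    Finset.sup'_induction hT f (p := fun g => Integrable g μ)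
      (fun _ h₁ _ h₂ => h₁.sup h₂) hf
  convert! h using 1
  ext ω
  rw [Finset.sup'_apply]

theorem integral_comp_measurePreserving {Ω' : Type*} [MeasurableSpace Ω'] {μ : Measure Ω}
    {ν : Measure Ω'} {φ : Ω → Ω'} (h : MeasurePreserving φ μ ν) {f : Ω' → ℝ}
    (hf : Integrable f ν) : ∫ x, f (φ x) ∂μ = ∫ y, f y ∂ν := by
  have hf' : AEStronglyMeasurable f (μ.map φ) := by rw [h.map_eq]; exact hf.1
  rw [← integral_map h.measurable.aemeasurable hf', h.map_eq]

theorem integrable_comp_eval_pi {μ : Measure Ω} [IsProbabilityMeasure μ] {f : Ω → ℝ}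
    (hf : Integrable f μ) (i : ι) :
    Integrable (fun ω : ι → Ω => f (ω i)) (Measure.pi fun _ => μ) :=
  (measurePreserving_eval (fun _ : ι => μ) i).integrable_comp_of_integrable hf

theorem integral_comp_eval_pi {μ : Measure Ω} [IsProbabilityMeasure μ] {f : Ω → ℝ}
    (hf : Integrable f μ) (i : ι) :
    ∫ ω : ι → Ω, f (ω i) ∂(Measure.pi fun _ => μ) = ∫ x, f x ∂μ :=
  integral_comp_measurePreserving (measurePreserving_eval (fun _ : ι => μ) i) hf

theorem integrable_signedSup {μ : Measure Ω} [IsProbabilityMeasure μ] (T : Finset τ)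
    (hT : T.Nonempty) {f : τ → Ω → ℝ} (hf : ∀ t, Integrable (f t) μ) (s : ι → ℤˣ) :
    Integrable (fun ω : ι → Ω => signedSup T hT (fun t i => f t (ω i)) s)
      (Measure.pi fun _ => μ) :=
  integrable_finset_sup' T hT fun t _ => integrable_finsetSum _ fun i _ =>
    (integrable_comp_eval_pi (hf t) i).const_mul _

/-- The centred supremum is dominated by its version with an independent ghost sample. -/
theorem integral_sup_centered_le_ghost (μ : Measure Ω) [IsProbabilityMeasure μ] (T : Finset τ)
    (hT : T.Nonempty) {f : τ → Ω → ℝ} (hf : ∀ t, Integrable (f t) μ) :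
    ∫ ω : ι → Ω, T.sup' hT (fun t => ∑ i, (∫ x, f t x ∂μ - f t (ω i))) ∂(Measure.pi fun _ => μ)
      ≤ ∫ z : ι → Ω × Ω, T.sup' hT (fun t => ∑ i, (f t (z i).2 - f t (z i).1))
        ∂(Measure.pi fun _ => μ.prod μ) := by
  set P : Measure (ι → Ω) := Measure.pi fun _ => μ
  let G : (ι → Ω) × (ι → Ω) → ℝ := fun q => T.sup' hT fun t => ∑ i, (f t (q.2 i) - f t (q.1 i))
  have he := measurePreserving_arrowProdEquivProdArrow Ω Ω ι (fun _ => μ) (fun _ => μ)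
  have hG : Integrable G (P.prod P) := integrable_finset_sup' T hT fun t _ =>
    integrable_finsetSum _ fun i _ => ((integrable_comp_eval_pi (hf t) i).comp_snd P).sub
      ((integrable_comp_eval_pi (hf t) i).comp_fst P)
  have hGz : ∫ z : ι → Ω × Ω, T.sup' hT (fun t => ∑ i, (f t (z i).2 - f t (z i).1))
      ∂(Measure.pi fun _ => μ.prod μ) = ∫ q, G q ∂(P.prod P) :=
    he.integral_comp (MeasurableEquiv.measurableEmbedding _) G
  rw [hGz, integral_prod _ hG]
  have hF : Integrable (fun ω : ι → Ω => T.sup' hT fun t => ∑ i, (∫ x, f t x ∂μ - f t (ω i))) P :=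
    integrable_finset_sup' T hT fun t _ => integrable_finsetSum _ fun i _ =>
      (integrable_const _).sub (integrable_comp_eval_pi (hf t) i)
  refine integral_mono_ae hF hG.integral_prod_left ?_
  filter_upwards [hG.prod_right_ae] with ω hω
  -- Jensen for the maximum: integrating out only the ghost sample gives back the centred sum.
  -- Fubini provides integrable sections only for almost every `ω`.
  refine Finset.sup'_le hT _ fun t ht => ?_
  have hint : ∀ i, Integrable (fun ω' : ι → Ω => f t (ω' i) - f t (ω i)) P := fun i =>
    (integrable_comp_eval_pi (hf t) i).sub (integrable_const _)
  calc ∑ i, (∫ x, f t x ∂μ - f t (ω i)) = ∫ ω' : ι → Ω, ∑ i, (f t (ω' i) - f t (ω i)) ∂P := by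
        rw [integral_finsetSum _ fun i _ => hint i]
        refine Finset.sum_congr rfl fun i _ => ?_
        rw [integral_sub (integrable_comp_eval_pi (hf t) i) (integrable_const _),
          integral_comp_eval_pi (hf t)]
        simp
    _ ≤ ∫ ω', G (ω, ω') ∂P := by
        refine integral_mono (integrable_finsetSum _ fun i _ => hint i) hω fun ω' => ?_
        exact Finset.le_sup' (fun t => ∑ i, (f t (ω' i) - f t (ω i))) ht

/-- Exchanging a sample point with its ghost where the sign is negative preserves the law. -/
theorem measurePreserving_swap_of_sign (μ : Measure Ω) [IsProbabilityMeasure μ] (s : ι → ℤˣ) :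
    MeasurePreserving (fun (z : ι → Ω × Ω) i => if s i = 1 then z i else (z i).swap)
      (Measure.pi fun _ => μ.prod μ) (Measure.pi fun _ => μ.prod μ) := by
  refine measurePreserving_pi (fun _ => μ.prod μ) (fun _ => μ.prod μ)
    (f := fun i x => if s i = 1 then x else x.swap) fun i => ?_
  by_cases h : s i = 1
  · simp only [h, if_true]
    exact MeasurePreserving.id _
  · simpa [h] using Measure.measurePreserving_swap

/-- Swapping with the ghost where `s i = -1` multiplies the `i`-th difference by `s i`; the supremum
then splits over the two samples. This holds for each fixed `s`, so averaging over signs can wait.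
-/
theorem integral_sup_centered_le_signedSup (μ : Measure Ω) [IsProbabilityMeasure μ]
    (T : Finset τ) (hT : T.Nonempty) {f : τ → Ω → ℝ}
    (hf : ∀ t, Integrable (f t) μ) (s : ι → ℤˣ) :
    ∫ ω : ι → Ω, T.sup' hT (fun t => ∑ i, (∫ x, f t x ∂μ - f t (ω i))) ∂(Measure.pi fun _ => μ)
      ≤ ∫ ω : ι → Ω, signedSup T hT (fun t i => f t (ω i)) s ∂(Measure.pi fun _ => μ)
        + ∫ ω : ι → Ω, signedSup T hT (fun t i => f t (ω i)) (-s) ∂(Measure.pi fun _ => μ) := by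
  refine (integral_sup_centered_le_ghost μ T hT hf).trans ?_
  set N : Measure (ι → Ω × Ω) := Measure.pi fun _ => μ.prod μ
  let G : (ι → Ω × Ω) → ℝ := fun z => T.sup' hT fun t => ∑ i, (f t (z i).2 - f t (z i).1)
  have hΦ := measurePreserving_swap_of_sign μ s
  have h1 : MeasurePreserving (fun (z : ι → Ω × Ω) i => (z i).1) N (Measure.pi fun _ => μ) :=
    measurePreserving_pi (fun _ => μ.prod μ) (fun _ => μ) fun _ => measurePreserving_fst
  have h2 : MeasurePreserving (fun (z : ι → Ω × Ω) i => (z i).2) N (Measure.pi fun _ => μ) :=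
    measurePreserving_pi (fun _ => μ.prod μ) (fun _ => μ) fun _ => measurePreserving_snd
  have hGi : Integrable G N := integrable_finset_sup' T hT fun t _ =>
    integrable_finsetSum _ fun i _ =>
      (h2.integrable_comp_of_integrable (integrable_comp_eval_pi (hf t) i)).sub
        (h1.integrable_comp_of_integrable (integrable_comp_eval_pi (hf t) i))
  have hI := integrable_signedSup (ι := ι) (μ := μ) T hT hf
  have eG : ∫ z, G (fun i => if s i = 1 then z i else (z i).swap) ∂N = ∫ z, G z ∂N :=
    integral_comp_measurePreserving hΦ hGi
  have i1 : Integrable (fun z : ι → Ω × Ω => signedSup T hT (fun t i => f t (z i).1) (-s)) N :=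
    h1.integrable_comp_of_integrable (hI (-s))
  have i2 : Integrable (fun z : ι → Ω × Ω => signedSup T hT (fun t i => f t (z i).2) s) N :=
    h2.integrable_comp_of_integrable (hI s)
  change ∫ z, G z ∂N ≤ _
  rw [← eG, ← integral_comp_measurePreserving h2 (hI s),
    ← integral_comp_measurePreserving h1 (hI (-s)), ← integral_add i2 i1]
  refine integral_mono (hΦ.integrable_comp_of_integrable hGi) (i2.add i1) fun z => ?_
  refine Finset.sup'_le hT _ fun t ht => ?_
  have l2 := Finset.le_sup' (fun t => ∑ i, ((s i : ℤ) : ℝ) * f t (z i).2) ht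
  have l1 := Finset.le_sup' (fun t => ∑ i, (((-s) i : ℤ) : ℝ) * f t (z i).1) ht
  refine le_trans (le_of_eq ?_) (add_le_add l2 l1)
  rw [← Finset.sum_add_distrib]
  refine Finset.sum_congr rfl fun i _ => ?_
  rcases Int.units_eq_one_or (s i) with hs | hs
  · simp [hs, sub_eq_add_neg]
  · have : (-1 : ℤˣ) ≠ 1 := by decide
    simp [hs, this]
    ring

/-- Symmetrization followed by contraction: if `f` is, coordinatewise in the parameter, a
contraction of `g`, its centred supremum is controlled by the Rademacher average of `g`. -/
theorem integral_sup_centered_le_of_contraction [DecidableEq ι] (μ : Measure Ω) [IsProbabilityMeasure μ]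
    (T : Finset τ) (hT : T.Nonempty) {f g : τ → Ω → ℝ} (hf : ∀ t, Integrable (f t) μ)
    (hg : ∀ t, Integrable (g t) μ) (h : ∀ x t u, |f t x - f u x| ≤ |g t x - g u x|) :
    Fintype.card (ι → ℤˣ) * ∫ ω : ι → Ω, T.sup' hT (fun t => ∑ i, (∫ x, f t x ∂μ - f t (ω i)))
        ∂(Measure.pi fun _ => μ)
      ≤ 2 * ∫ ω : ι → Ω, ∑ s, signedSup T hT (fun t i => g t (ω i)) s
        ∂(Measure.pi fun _ => μ) := by
  have hs := Finset.sum_le_sum fun s (_ : s ∈ (Finset.univ : Finset (ι → ℤˣ))) =>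
    integral_sup_centered_le_signedSup μ T hT hf s
  have hneg : ∑ s : ι → ℤˣ, ∫ ω : ι → Ω, signedSup T hT (fun t i => f t (ω i)) (-s)
      ∂(Measure.pi fun _ => μ) = ∑ s : ι → ℤˣ,
        ∫ ω : ι → Ω, signedSup T hT (fun t i => f t (ω i)) s ∂(Measure.pi fun _ => μ) :=
    Equiv.sum_comp (Equiv.neg (ι → ℤˣ)) fun s =>
      ∫ ω : ι → Ω, signedSup T hT (fun t i => f t (ω i)) s ∂(Measure.pi fun _ => μ)
  rw [Finset.sum_add_distrib, hneg, ← integral_finsetSum _ fun s _ =>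
    integrable_signedSup T hT hf s, Finset.sum_const, Finset.card_univ, nsmul_eq_mul,
    ← two_mul] at hs
  refine hs.trans ?_
  gcongr
  · exact integrable_finsetSum _ fun s _ => integrable_signedSup T hT hf s
  · exact integrable_finsetSum _ fun s _ => integrable_signedSup T hT hg s
  · exact fun ω => sum_signedSup_le_of_contraction T hT fun i t u => h (ω i) t u

/-- Uniform deviations of contractions of linear functionals over a bounded index set. -/
theorem integral_sup_centered_le_of_inner {E : Type*} [NormedAddCommGroup E]
    [InnerProductSpace ℝ E] [MeasurableSpace E] [BorelSpace E] [SecondCountableTopology E]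
    (μ : Measure Ω) [IsProbabilityMeasure μ] (T : Finset τ) (hT : T.Nonempty) {f : τ → Ω → ℝ}
    (hf : ∀ t, Integrable (f t) μ) {X : Ω → E} (hX : MemLp X 2 μ) (v : τ → E) {r : ℝ}
    (hr : 0 ≤ r) (hv : ∀ t, ‖v t‖ ≤ r)
    (h : ∀ x t u, |f t x - f u x| ≤ |inner ℝ (X x) (v t) - inner ℝ (X x) (v u)|)
    {q : ℝ} (hq : ∫ x, ‖X x‖ ^ 2 ∂μ ≤ q) :
    ∫ ω : ι → Ω, T.sup' hT (fun t => ∑ i, (∫ x, f t x ∂μ - f t (ω i)))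
        ∂(Measure.pi fun _ => μ)
      ≤ 2 * r * √(Fintype.card ι * q) := by
  classical
  set P : Measure (ι → Ω) := Measure.pi fun _ => μ
  have hXi : Integrable X μ := hX.integrable (by norm_num)
  have hX2 : Integrable (fun x => ‖X x‖ ^ 2) μ := hX.integrable_norm_pow (by norm_num)
  have hmain := integral_sup_centered_le_of_contraction (ι := ι) μ T hT hf
    (g := fun t x => inner ℝ (X x) (v t)) (fun t => hXi.inner_const (v t)) h
  set N : ℝ := ((Fintype.card (ι → ℤˣ) : ℕ) : ℝ) with hN
  have hNpos : 0 < N := by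
    rw [hN]
    exact_mod_cast Fintype.card_pos
  -- The inequality `2‖S‖ ≤ l + ‖S‖²/l` leaves only squared norms to average; the choice `l = √(card
  -- ι * q)` at the end recovers the Cauchy–Schwarz bound.
  have hbound : ∀ l : ℝ, 0 < l → ∀ ω : ι → Ω,
      ∑ s, signedSup T hT (fun t i => inner ℝ (X (ω i)) (v t)) s
        ≤ N * (r / 2 * (l + (∑ i, ‖X (ω i)‖ ^ 2) / l)) := by
    intro l hl ω
    have hs : ∀ s : ι → ℤˣ, signedSup T hT (fun t i => inner ℝ (X (ω i)) (v t)) s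
        ≤ r / 2 * (l + ‖∑ i, ((s i : ℤ) : ℝ) • X (ω i)‖ ^ 2 / l) := by
      intro s
      refine Finset.sup'_le hT _ fun t _ => ?_
      have e : ∑ i, ((s i : ℤ) : ℝ) * inner ℝ (X (ω i)) (v t)
          = inner ℝ (∑ i, ((s i : ℤ) : ℝ) • X (ω i)) (v t) := by
        rw [sum_inner]
        exact Finset.sum_congr rfl fun i _ => by rw [real_inner_smul_left]
      rw [e]
      set S := ∑ i, ((s i : ℤ) : ℝ) • X (ω i)
      have h1 : inner ℝ S (v t) ≤ ‖S‖ * r := (real_inner_le_norm _ _).trans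
        (mul_le_mul_of_nonneg_left (hv t) (norm_nonneg _))
      have h2 : 2 * ‖S‖ ≤ l + ‖S‖ ^ 2 / l := by
        rw [← sub_nonneg]
        have : l + ‖S‖ ^ 2 / l - 2 * ‖S‖ = (l - ‖S‖) ^ 2 / l := by field_simp; ring
        rw [this]
        positivity
      nlinarith [norm_nonneg S]
    refine (Finset.sum_le_sum fun s _ => hs s).trans (le_of_eq ?_)
    rw [← Finset.mul_sum, Finset.sum_add_distrib, ← Finset.sum_div, sum_norm_sq_sign_smul]
    simp only [Finset.sum_const, Finset.card_univ, nsmul_eq_mul]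
    rw [← hN]
    ring
  have hsq : Integrable (fun ω : ι → Ω => ∑ i, ‖X (ω i)‖ ^ 2) P :=
    integrable_finsetSum _ fun i _ => integrable_comp_eval_pi hX2 i
  have hsum : ∫ ω : ι → Ω, ∑ i, ‖X (ω i)‖ ^ 2 ∂P ≤ Fintype.card ι * q := by
    rw [integral_finsetSum _ fun i _ => integrable_comp_eval_pi hX2 i]
    simp only [integral_comp_eval_pi hX2, Finset.sum_const, Finset.card_univ, nsmul_eq_mul]
    gcongr
  have hl : ∀ l : ℝ, 0 < l → ∫ ω : ι → Ω, T.sup' hT (fun t => ∑ i, (∫ x, f t x ∂μ - f t (ω i))) ∂P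
      ≤ r * (l + Fintype.card ι * q / l) := by
    intro l hl
    have h1 : ∫ ω : ι → Ω, ∑ s, signedSup T hT (fun t i => inner ℝ (X (ω i)) (v t)) s ∂P
        ≤ ∫ ω : ι → Ω, N * (r / 2 * (l + (∑ i, ‖X (ω i)‖ ^ 2) / l)) ∂P :=
      integral_mono (integrable_finsetSum _ fun s _ =>
          integrable_signedSup T hT (fun t => hXi.inner_const (v t)) s)
        ((((integrable_const l).add (hsq.div_const l)).const_mul _).const_mul _) (hbound l hl)
    rw [integral_const_mul, integral_const_mul,
      integral_add (integrable_const l) (hsq.div_const l), integral_div] at h1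
    simp only [integral_const, probReal_univ, one_smul] at h1
    have h2 : (∫ ω : ι → Ω, ∑ i, ‖X (ω i)‖ ^ 2 ∂P) / l ≤ Fintype.card ι * q / l := by gcongr
    have h3 : N * (r / 2 * (l + (∫ ω : ι → Ω, ∑ i, ‖X (ω i)‖ ^ 2 ∂P) / l))
        ≤ N * (r / 2 * (l + Fintype.card ι * q / l)) := by gcongr
    refine le_of_mul_le_mul_left ?_ hNpos
    linarith
  have hq0 : 0 ≤ Fintype.card ι * q := mul_nonneg (by positivity)
    ((integral_nonneg fun x => by positivity).trans hq)
  -- When the optimal `l` is zero it is not admissible, so `l` is sent to zero instead.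
  rcases hq0.eq_or_lt with h0 | hpos
  · rw [← h0, Real.sqrt_zero, mul_zero]
    refine le_of_forall_pos_le_add fun e he => ?_
    have hr1 : 0 < r + 1 := by linarith
    have := hl (e / (r + 1)) (by positivity)
    rw [← h0, zero_div, add_zero] at this
    have h4 : r * (e / (r + 1)) ≤ e := by
      rw [mul_div_assoc', div_le_iff₀ hr1]
      nlinarith
    linarith
  · have := hl _ (Real.sqrt_pos.2 hpos)
    rw [Real.div_sqrt] at this
    linarith

end Symmetrization

/-! ### Gaussian absolute moments -/

section GaussianAbs

/-- The mean absolute value of a standard normal variable. -/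
noncomputable def gaussianAbsMean : ℝ := ∫ z, |z| ∂(gaussianReal 0 1)

theorem integrable_abs_gaussianReal (m : ℝ) (v : NNReal) :
    Integrable (fun z => |z|) (gaussianReal m v) :=
  (memLp_id_gaussianReal (μ := m) (v := v) 1).integrable (by simp) |>.abs

theorem gaussianAbsMean_pos : 0 < gaussianAbsMean := by
  unfold gaussianAbsMean
  rw [integral_pos_iff_support_of_nonneg (fun z => abs_nonneg z) (integrable_abs_gaussianReal 0 1)]
  have : Function.support (fun z : ℝ => |z|) = {0}ᶜ := by
    ext z
    simp
  have := nullSingletonClass_gaussianReal (μ := 0) (v := 1) one_ne_zero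
  rw [‹Function.support _ = _›, prob_compl_eq_one_sub (measurableSet_singleton 0)]
  simp

theorem integral_abs_gaussianReal_zero {s : ℝ} (hs : 0 ≤ s) :
    ∫ z, |z| ∂(gaussianReal 0 (s ^ 2).toNNReal) = s * gaussianAbsMean := by
  have h : (gaussianReal 0 1).map (s * ·) = gaussianReal 0 (s ^ 2).toNNReal := by
    rw [gaussianReal_map_const_mul]
    congr 1
    · simp
    · ext
      simp [Real.coe_toNNReal _ (sq_nonneg s)]
  rw [← h, integral_map (by fun_prop) (by fun_prop), gaussianAbsMean, ← integral_const_mul]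
  simp [abs_mul, abs_of_nonneg hs]

/-- Independent centred Gaussians add their variances. In the application `x` is the linear
perturbation and `y` the noise. -/
theorem integral_abs_add_gaussianReal {s t : ℝ} :
    Integrable (fun x => ∫ y, |x + y| ∂(gaussianReal 0 (s ^ 2).toNNReal))
        (gaussianReal 0 (t ^ 2).toNNReal)
      ∧ ∫ x, ∫ y, |x + y| ∂(gaussianReal 0 (s ^ 2).toNNReal) ∂(gaussianReal 0 (t ^ 2).toNNReal)
        = √(s ^ 2 + t ^ 2) * gaussianAbsMean := by
  have hconv : gaussianReal 0 (t ^ 2).toNNReal ∗ gaussianReal 0 (s ^ 2).toNNReal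
      = gaussianReal 0 (√(s ^ 2 + t ^ 2) ^ 2).toNNReal := by
    rw [gaussianReal_conv_gaussianReal, Real.sq_sqrt (by positivity), add_zero,
      ← Real.toNNReal_add (sq_nonneg t) (sq_nonneg s), add_comm]
  have hint : Integrable (fun z => |z|)
      (gaussianReal 0 (t ^ 2).toNNReal ∗ gaussianReal 0 (s ^ 2).toNNReal) := by
    rw [hconv]
    exact integrable_abs_gaussianReal _ _
  refine ⟨?_, ?_⟩
  · have h2 : Integrable (fun q : ℝ × ℝ => |q.1 + q.2|)
        ((gaussianReal 0 (t ^ 2).toNNReal).prod (gaussianReal 0 (s ^ 2).toNNReal)) := by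
      rw [Measure.conv] at hint
      exact hint.comp_measurable (by fun_prop)
    exact h2.integral_prod_left
  · rw [← integral_conv hint, hconv, integral_abs_gaussianReal_zero (Real.sqrt_nonneg _)]

variable {p : ℕ}

theorem stdGaussian_map_inner (δ : EuclideanSpace ℝ (Fin p)) :
    (stdGaussian (EuclideanSpace ℝ (Fin p))).map (fun x => inner ℝ x δ)
      = gaussianReal 0 (‖δ‖ ^ 2).toNNReal := by
  have h := IsGaussian.map_eq_gaussianReal (μ := stdGaussian (EuclideanSpace ℝ (Fin p)))
    (innerSL ℝ δ)
  rw [integral_strongDual_stdGaussian, variance_dual_stdGaussian, innerSL_apply_norm] at h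
  rw [← h]
  congr 1
  ext x
  simp [real_inner_comm]

theorem measurePreserving_inner_stdGaussian (δ : EuclideanSpace ℝ (Fin p)) :
    MeasurePreserving (fun x => inner ℝ x δ) (stdGaussian (EuclideanSpace ℝ (Fin p)))
      (gaussianReal 0 (‖δ‖ ^ 2).toNNReal) :=
  ⟨by fun_prop, stdGaussian_map_inner δ⟩

theorem integral_norm_sq_stdGaussian :
    ∫ x, ‖x‖ ^ 2 ∂(stdGaussian (EuclideanSpace ℝ (Fin p))) = p := by
  have hc : ∀ i : Fin p, MeasurePreserving (fun x : EuclideanSpace ℝ (Fin p) => x i)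
      (stdGaussian (EuclideanSpace ℝ (Fin p))) (gaussianReal 0 1) := by
    intro i
    simpa [EuclideanSpace.inner_single_right] using
      measurePreserving_inner_stdGaussian (EuclideanSpace.single i (1 : ℝ))
  have hsq : Integrable (fun z : ℝ => z ^ 2) (gaussianReal 0 1) :=
    (memLp_id_gaussianReal 2).integrable_sq
  have hone : ∫ z : ℝ, z ^ 2 ∂(gaussianReal 0 1) = 1 := by
    have := variance_of_integral_eq_zero (μ := gaussianReal 0 1) (X := id) (by fun_prop)
      (by simp)
    rw [variance_id_gaussianReal] at this
    simpa using this.symm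
  simp_rw [EuclideanSpace.real_norm_sq_eq]
  have hcsq : ∀ i : Fin p, Integrable (fun x : EuclideanSpace ℝ (Fin p) => x i ^ 2)
      (stdGaussian (EuclideanSpace ℝ (Fin p))) := fun i =>
    (hc i).integrable_comp_of_integrable hsq
  rw [integral_finsetSum _ fun i _ => hcsq i]
  simp [fun i => integral_comp_measurePreserving (hc i) hsq, hone]

end GaussianAbs

/-! ### Population excess loss -/

section Population

variable {p : ℕ}

/-- The increase of the absolute loss at one observation when `β` is replaced by `β + δ`. -/
noncomputable def excessLoss (β δ : EuclideanSpace ℝ (Fin p))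
    (z : EuclideanSpace ℝ (Fin p) × ℝ) : ℝ :=
  |z.2 - inner ℝ z.1 (β + δ)| - |z.2 - inner ℝ z.1 β|

theorem measurable_excessLoss (β δ : EuclideanSpace ℝ (Fin p)) :
    Measurable (excessLoss β δ) := by
  unfold excessLoss
  fun_prop

/-- The term at `β` cancels and the reverse triangle inequality removes `y`: this is the source of
robustness to arbitrary responses. -/
theorem abs_excessLoss_sub_le (β δ η : EuclideanSpace ℝ (Fin p))
    (z : EuclideanSpace ℝ (Fin p) × ℝ) :
    |excessLoss β δ z - excessLoss β η z| ≤ |inner ℝ z.1 δ - inner ℝ z.1 η| := by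
  unfold excessLoss
  rw [sub_sub_sub_cancel_right]
  refine (abs_abs_sub_abs_le_abs_sub _ _).trans (le_of_eq ?_)
  rw [abs_sub_comm]
  congr 1
  simp only [inner_add_right]
  ring

theorem abs_excessLoss_le (β δ : EuclideanSpace ℝ (Fin p))
    (z : EuclideanSpace ℝ (Fin p) × ℝ) : |excessLoss β δ z| ≤ |inner ℝ z.1 δ| := by
  simpa [excessLoss] using abs_excessLoss_sub_le β δ 0 z

variable (β : EuclideanSpace ℝ (Fin p)) (σ ε : ℝ) (Q : Kernel (EuclideanSpace ℝ (Fin p)) ℝ)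

theorem measurePreserving_fst_adaptiveLaw [IsMarkovKernel (contaminatedResponse β σ ε Q)] :
    MeasurePreserving Prod.fst (adaptiveLaw β σ ε Q)
      (stdGaussian (EuclideanSpace ℝ (Fin p))) := by
  refine ⟨measurable_fst, ?_⟩
  unfold adaptiveLaw
  exact Measure.fst_compProd _ _

theorem integrable_excessLoss [IsMarkovKernel (contaminatedResponse β σ ε Q)]
    (δ : EuclideanSpace ℝ (Fin p)) : Integrable (excessLoss β δ) (adaptiveLaw β σ ε Q) := by
  have h : Integrable (fun z : EuclideanSpace ℝ (Fin p) × ℝ => |inner ℝ z.1 δ|)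
      (adaptiveLaw β σ ε Q) :=
    ((measurePreserving_inner_stdGaussian δ).comp
      (measurePreserving_fst_adaptiveLaw β σ ε Q)).integrable_comp_of_integrable
        (integrable_abs_gaussianReal 0 _)
  exact h.mono' (measurable_excessLoss β δ).aestronglyMeasurable
    (Filter.Eventually.of_forall fun z => abs_excessLoss_le β δ z)

theorem integral_excessLoss_gaussianReal {σ : ℝ} (hσ : 0 ≤ σ) (δ x : EuclideanSpace ℝ (Fin p)) :
    ∫ y, excessLoss β δ (x, y) ∂(gaussianReal (inner ℝ x β) (σ ^ 2).toNNReal)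
      = ∫ y, |inner ℝ x (-δ) + y| ∂(gaussianReal 0 (σ ^ 2).toNNReal) - σ * gaussianAbsMean := by
  have h : MeasurePreserving (fun y => y - inner ℝ x β)
      (gaussianReal (inner ℝ x β) (σ ^ 2).toNNReal) (gaussianReal 0 (σ ^ 2).toNNReal) :=
    ⟨by fun_prop, by rw [gaussianReal_map_sub_const, sub_self]⟩
  have hi : Integrable (fun y : ℝ => |inner ℝ x (-δ) + y|) (gaussianReal 0 (σ ^ 2).toNNReal) :=
    ((integrable_const _).add
      ((memLp_id_gaussianReal (μ := 0) (v := (σ ^ 2).toNNReal) 1).integrable (by simp))).abs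
  rw [← integral_abs_gaussianReal_zero hσ, ← integral_sub hi (integrable_abs_gaussianReal 0 _),
    ← integral_comp_measurePreserving h
      (f := fun y => |inner ℝ x (-δ) + y| - |y|) (hi.sub (integrable_abs_gaussianReal 0 _))]
  refine integral_congr_ae (Filter.Eventually.of_forall fun y => ?_)
  simp only [excessLoss, inner_add_right, inner_neg_right]
  congr 2
  ring

/-- The population excess loss grows like the clean Gaussian one, up to the contamination. -/
theorem le_integral_excessLoss [IsMarkovKernel Q] (hσ : 0 ≤ σ) (hε0 : 0 ≤ ε) (hε1 : ε ≤ 1)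
    (δ : EuclideanSpace ℝ (Fin p)) :
    gaussianAbsMean * ((1 - ε) * (√(σ ^ 2 + ‖δ‖ ^ 2) - σ) - ε * ‖δ‖)
      ≤ ∫ z, excessLoss β δ z ∂(adaptiveLaw β σ ε Q) := by
  have := isMarkovKernel_contaminatedResponse β σ ε hε0 hε1 Q
  have hint := integrable_excessLoss β σ ε Q δ
  unfold adaptiveLaw at hint ⊢
  rw [Measure.integral_compProd hint]
  have hneg := measurePreserving_inner_stdGaussian (-δ)
  rw [norm_neg] at hneg
  obtain ⟨hi, he⟩ := integral_abs_add_gaussianReal (s := σ) (t := ‖δ‖)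
  have hclean : Integrable (fun x => ∫ y, |inner ℝ x (-δ) + y| ∂(gaussianReal 0 (σ ^ 2).toNNReal))
      (stdGaussian (EuclideanSpace ℝ (Fin p))) := hneg.integrable_comp_of_integrable hi
  have habs : Integrable (fun x => |inner ℝ x δ|)
      (stdGaussian (EuclideanSpace ℝ (Fin p))) := (measurePreserving_inner_stdGaussian δ).integrable_comp_of_integrable
    (integrable_abs_gaussianReal 0 _)
  have hdiff : Integrable (fun x => (1 - ε) *
      (∫ y, |inner ℝ x (-δ) + y| ∂(gaussianReal 0 (σ ^ 2).toNNReal) - σ * gaussianAbsMean))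
      (stdGaussian (EuclideanSpace ℝ (Fin p))) := (hclean.sub (integrable_const _)).const_mul _
  have hlow : ∫ x, ((1 - ε) * (∫ y, |inner ℝ x (-δ) + y| ∂(gaussianReal 0 (σ ^ 2).toNNReal)
      - σ * gaussianAbsMean) - ε * |inner ℝ x δ|) ∂(stdGaussian (EuclideanSpace ℝ (Fin p)))
      = gaussianAbsMean * ((1 - ε) * (√(σ ^ 2 + ‖δ‖ ^ 2) - σ) - ε * ‖δ‖) := by
    rw [integral_sub hdiff (habs.const_mul _),
      integral_const_mul, integral_const_mul, integral_sub hclean (integrable_const _)]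
    have e1 := integral_comp_measurePreserving hneg hi
    have e2 := integral_comp_measurePreserving (measurePreserving_inner_stdGaussian δ)
      (integrable_abs_gaussianReal 0 _)
    rw [he] at e1
    rw [integral_abs_gaussianReal_zero (norm_nonneg δ)] at e2
    rw [e1, e2]
    simp only [integral_const, probReal_univ, one_smul]
    ring
  rw [← hlow]
  refine integral_mono (hdiff.sub (habs.const_mul _))
    hint.integral_compProd fun x => ?_
  -- For fixed `x` the excess loss is bounded in `y`, so no moments of `Q x` are needed.
  have hb : ∀ (ν : Measure ℝ) [IsFiniteMeasure ν],
      Integrable (fun y => excessLoss β δ (x, y)) ν := fun ν _ =>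
    (integrable_const |inner ℝ x δ|).mono'
      ((measurable_excessLoss β δ).comp measurable_prodMk_left).aestronglyMeasurable
      (Filter.Eventually.of_forall fun y => abs_excessLoss_le β δ (x, y))
  have hmix : ∫ y, excessLoss β δ (x, y) ∂(contaminatedResponse β σ ε Q x)
      = (1 - ε) * ∫ y, excessLoss β δ (x, y) ∂(gaussianReal (inner ℝ x β) (σ ^ 2).toNNReal)
        + ε * ∫ y, excessLoss β δ (x, y) ∂(Q x) := by
    change ∫ y, excessLoss β δ (x, y) ∂(ENNReal.ofReal (1 - ε) •
      gaussianReal (inner ℝ x β) (σ ^ 2).toNNReal + ENNReal.ofReal ε • Q x) = _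
    rw [integral_add_measure ((hb _).smul_measure ENNReal.ofReal_ne_top)
        ((hb _).smul_measure ENNReal.ofReal_ne_top), integral_smul_measure,
      integral_smul_measure, ENNReal.toReal_ofReal (by linarith), ENNReal.toReal_ofReal hε0]
    rfl
  have hQ : -|inner ℝ x δ| ≤ ∫ y, excessLoss β δ (x, y) ∂(Q x) := by
    have := integral_mono (integrable_const (-|inner ℝ x δ|)) (hb (Q x)) fun y =>
      (abs_le.1 (abs_excessLoss_le β δ (x, y))).1
    simpa using this
  change _ ≤ ∫ y, excessLoss β δ (x, y) ∂(contaminatedResponse β σ ε Q x)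
  rw [hmix, integral_excessLoss_gaussianReal β hσ]
  have := mul_le_mul_of_nonneg_left hQ hε0
  linarith

end Population

/-! ### Localization by convexity and the choice of radius -/

section MedianRegression

variable {n p : ℕ}

theorem continuous_absLoss (d : Fin n → EuclideanSpace ℝ (Fin p) × ℝ) :
    Continuous (absLoss d) := by
  unfold absLoss
  fun_prop

theorem convexOn_absLoss (d : Fin n → EuclideanSpace ℝ (Fin p) × ℝ) :
    ConvexOn ℝ Set.univ (absLoss d) := by
  refine ⟨convex_univ, fun b _ b' _ u v hu hv huv => ?_⟩
  unfold absLoss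
  rw [smul_eq_mul, smul_eq_mul, mul_left_comm u, mul_left_comm v, ← mul_add]
  refine mul_le_mul_of_nonneg_left ?_ (by positivity)
  rw [Finset.mul_sum, Finset.mul_sum, ← Finset.sum_add_distrib]
  refine Finset.sum_le_sum fun i _ => ?_
  have e : (d i).2 - inner ℝ (d i).1 (u • b + v • b')
      = u * ((d i).2 - inner ℝ (d i).1 b) + v * ((d i).2 - inner ℝ (d i).1 b') := by
    rw [inner_add_right, real_inner_smul_right, real_inner_smul_right]
    linear_combination (-(d i).2) * huv
  rw [e]
  refine (abs_add_le _ _).trans ?_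
  rw [abs_mul, abs_mul, abs_of_nonneg hu, abs_of_nonneg hv]

theorem absLoss_sub_eq (d : Fin n → EuclideanSpace ℝ (Fin p) × ℝ)
    (β δ : EuclideanSpace ℝ (Fin p)) :
    absLoss d (β + δ) - absLoss d β = (1 / (n : ℝ)) * ∑ i, excessLoss β δ (d i) := by
  simp only [absLoss, excessLoss, Finset.sum_sub_distrib, mul_sub]

/-- If the loss at the centre of a ball is smaller than everywhere on its sphere, then minimizers
exist and all lie in the ball. -/
theorem medianRegression_localized (d : Fin n → EuclideanSpace ℝ (Fin p) × ℝ)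
    (β : EuclideanSpace ℝ (Fin p)) {t : ℝ} (ht : 0 < t)
    (h : ∀ δ : EuclideanSpace ℝ (Fin p), ‖δ‖ = t → absLoss d β < absLoss d (β + δ)) :
    (∃ b, IsMedianRegression d b) ∧ ∀ b, IsMedianRegression d b → ‖b - β‖ ≤ t := by
  have hout : ∀ b, t < ‖b - β‖ → absLoss d β < absLoss d b := by
    intro b hb
    have hpos : 0 < ‖b - β‖ := ht.trans hb
    -- The segment from `β` to `b` crosses the sphere at parameter `l`.
    set l := t / ‖b - β‖ with hl
    have hl0 : 0 < l := div_pos ht hpos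
    have hl1 : l < 1 := (div_lt_one hpos).2 hb
    have hlt := h (l • (b - β)) (by
      rw [norm_smul, Real.norm_of_nonneg hl0.le, hl, div_mul_cancel₀ _ hpos.ne'])
    have hconv := (convexOn_absLoss d).2 (Set.mem_univ β) (Set.mem_univ b)
      (by linarith : 0 ≤ 1 - l) hl0.le (by ring)
    have e : (1 - l) • β + l • b = β + l • (b - β) := by
      rw [sub_smul, one_smul, smul_sub]
      abel
    rw [e, smul_eq_mul, smul_eq_mul] at hconv
    by_contra! hle
    nlinarith
  obtain ⟨b, -, hbmin⟩ := (isCompact_closedBall β t).exists_isMinOn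
    ⟨β, Metric.mem_closedBall_self ht.le⟩ (continuous_absLoss d).continuousOn
  refine ⟨⟨b, fun b' => ?_⟩, fun b hb => ?_⟩
  · rcases le_or_gt ‖b' - β‖ t with h' | h'
    · exact hbmin (mem_closedBall_iff_norm.2 h')
    · exact (hbmin (Metric.mem_closedBall_self ht.le)).trans (hout b' h').le
  · by_contra! hlt
    exact absurd (hb β) (not_le.2 (hout b hlt))

/-- With high probability the excess loss is uniformly close to its mean from below, along any
bounded sequence of perturbations. -/
theorem measure_exists_deviation_le (β : EuclideanSpace ℝ (Fin p)) (σ ε : ℝ)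
    (Q : Kernel (EuclideanSpace ℝ (Fin p)) ℝ) [IsMarkovKernel (contaminatedResponse β σ ε Q)]
    {v : ℕ → EuclideanSpace ℝ (Fin p)} (hv0 : v 0 = 0) {t : ℝ} (ht : 0 ≤ t)
    (hv : ∀ k, ‖v k‖ ≤ t) {M : ℝ} (hM : 0 < M) :
    adaptiveSampleLaw n β σ ε Q {d | ∃ k, M <
        ∑ i, (∫ z, excessLoss β (v k) z ∂(adaptiveLaw β σ ε Q) - excessLoss β (v k) (d i))}
      ≤ ENNReal.ofReal (2 * t * √(n * p) / M) := by
  have hprob : IsProbabilityMeasure (adaptiveLaw β σ ε Q) := by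
    unfold adaptiveLaw
    infer_instance
  set μ := adaptiveLaw β σ ε Q
  let D : ℕ → (Fin n → EuclideanSpace ℝ (Fin p) × ℝ) → ℝ := fun k d =>
    ∑ i, (∫ z, excessLoss β (v k) z ∂μ - excessLoss β (v k) (d i))
  -- Continuity from below reduces to finite families, with a bound independent of `N`.
  have hunion : {d | ∃ k, M < D k d} = ⋃ N, {d | ∃ k ∈ Finset.range (N + 1), M < D k d} := by
    ext d
    simp only [Set.mem_ofPred_eq, Set.mem_iUnion]
    exact ⟨fun ⟨k, hk⟩ => ⟨k, k, by simp, hk⟩, fun ⟨_, k, _, hk⟩ => ⟨k, hk⟩⟩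
  have hmono : Monotone fun N => {d | ∃ k ∈ Finset.range (N + 1), M < D k d} := by
    rintro N N' hN d ⟨k, hk, hkM⟩
    exact ⟨k, Finset.range_subset_range.2 (by omega) hk, hkM⟩
  change (Measure.pi fun _ => μ) {d | ∃ k, M < D k d} ≤ _
  rw [hunion, hmono.measure_iUnion]
  refine iSup_le fun N => ?_
  set T := Finset.range (N + 1)
  have h0 : 0 ∈ T := by simp [T]
  have hT : T.Nonempty := ⟨0, h0⟩
  have hf := fun k => integrable_excessLoss β σ ε Q (v k)
  have hfst := measurePreserving_fst_adaptiveLaw β σ ε Q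
  have hX : MemLp Prod.fst 2 μ := by
    have : MemLp (id : EuclideanSpace ℝ (Fin p) → _) 2 (stdGaussian _) := IsGaussian.memLp_two_id
    exact this.comp_measurePreserving hfst
  have hq : ∫ z, ‖z.1‖ ^ 2 ∂μ ≤ p := by
    have h2 : Integrable (fun x => ‖x‖ ^ 2) (stdGaussian (EuclideanSpace ℝ (Fin p))) :=
      (IsGaussian.memLp_two_id (μ := stdGaussian (EuclideanSpace ℝ (Fin p)))).integrable_norm_pow
        (by norm_num)
    exact (integral_comp_measurePreserving hfst h2).trans integral_norm_sq_stdGaussian |>.le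
  have hE := integral_sup_centered_le_of_inner (ι := Fin n) μ T hT hf hX v ht hv
    (fun z k l => abs_excessLoss_sub_le β (v k) (v l) z) hq
  rw [Fintype.card_fin] at hE
  have hint : Integrable (fun d => T.sup' hT fun k => D k d) (Measure.pi fun _ : Fin n => μ) :=
    integrable_finset_sup' T hT fun k _ => integrable_finsetSum _ fun i _ =>
      (integrable_const _).sub (integrable_comp_eval_pi (hf k) i)
  -- The zero perturbation has no deviation, which gives the nonnegativity Markov's inequality
  -- requires.
  have hnn : ∀ d, 0 ≤ T.sup' hT fun k => D k d := by
    intro d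
    have h1 : D 0 d = 0 := by simp [D, hv0, excessLoss]
    have h2 := Finset.le_sup' (fun k => D k d) h0
    rw [h1] at h2
    exact h2
  have hmarkov := mul_meas_ge_le_integral_of_nonneg (Filter.Eventually.of_forall hnn) hint M
  have hreal : (Measure.pi fun _ : Fin n => μ).real {d | M ≤ T.sup' hT fun k => D k d}
      ≤ 2 * t * √(n * p) / M := by
    rw [le_div_iff₀ hM, mul_comm]
    exact hmarkov.trans hE
  refine le_trans (measure_mono ?_) ((ENNReal.le_ofReal_iff_toReal_le (measure_ne_top _ _)
    (by positivity)).2 hreal)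
  rintro d ⟨k, hk, hkM⟩
  exact hkM.le.trans (Finset.le_sup' (fun k => D k d) hk)

/-- After squaring, `t ≤ σ` bounds the added terms by `(2/3 + 1/9) * t²`, below `t²`. -/
theorem add_sq_div_le_sqrt {σ t : ℝ} (hσ : 0 < σ) (ht : 0 ≤ t) (htσ : t ≤ σ) :
    σ + t ^ 2 / (3 * σ) ≤ √(σ ^ 2 + t ^ 2) := by
  refine Real.le_sqrt_of_sq_le ?_
  have h : t ^ 2 / (3 * σ) ≤ t / 3 := by
    rw [div_le_div_iff₀ (by positivity) (by norm_num)]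
    nlinarith
  have h2 : σ * (t ^ 2 / (3 * σ)) = t ^ 2 / 3 := by field_simp
  have h3 : 0 ≤ t ^ 2 / (3 * σ) := by positivity
  nlinarith

/-- For a suitable radius, the loss on the sphere around the true parameter exceeds the loss at its
centre with probability at least `1 - α`. -/
theorem measure_compl_sphere_separated_le {α : ℝ} (hα : 0 < α) (hn : 0 < n) (hp : 0 < p)
    (β : EuclideanSpace ℝ (Fin p)) {σ ε : ℝ} (hσ : 0 < σ) (hε0 : 0 ≤ ε) (hε1 : ε ≤ 1 / 2)
    (Q : Kernel (EuclideanSpace ℝ (Fin p)) ℝ) [IsMarkovKernel Q] {t : ℝ} (htσ : t ≤ σ)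
    (ht : 6 * (1 + 2 / (α * gaussianAbsMean)) * σ * (√((p : ℝ) / n) + ε) = t) :
    adaptiveSampleLaw n β σ ε Q
        {d | ∀ δ : EuclideanSpace ℝ (Fin p), ‖δ‖ = t → absLoss d β < absLoss d (β + δ)}ᶜ
      ≤ ENNReal.ofReal α := by
  have := isMarkovKernel_contaminatedResponse β σ ε hε0 (by linarith) Q
  have hκ := gaussianAbsMean_pos
  have hn' : (0 : ℝ) < n := by exact_mod_cast hn
  have hp' : (0 : ℝ) < p := by exact_mod_cast hp
  set κ := gaussianAbsMean
  set s := √((p : ℝ) / n) with hs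
  have hs0 : 0 < s := Real.sqrt_pos.2 (by positivity)
  have ht0 : 0 < t := by rw [← ht]; positivity
  have hsn : √((n : ℝ) * p) = n * s := by
    rw [hs, ← Real.sqrt_sq hn'.le, ← Real.sqrt_mul (by positivity), Real.sqrt_sq hn'.le]
    congr 1
    field_simp
  have : Nonempty (Fin p) := ⟨⟨0, hp⟩⟩
  have hsphere : Nonempty (Metric.sphere (0 : EuclideanSpace ℝ (Fin p)) t) :=
    (NormedSpace.sphere_nonempty.2 ht0.le).to_subtype
  let u : ℕ → Metric.sphere (0 : EuclideanSpace ℝ (Fin p)) t := TopologicalSpace.denseSeq _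
  -- Index `0` is reserved for the zero vector, so the dense sequence of the sphere is shifted by
  -- one.
  let v : ℕ → EuclideanSpace ℝ (Fin p) := fun k => Nat.casesOn k 0 fun j => (u j : _)
  have hu : ∀ w : Metric.sphere (0 : EuclideanSpace ℝ (Fin p)) t,
      ‖(w : EuclideanSpace ℝ (Fin p))‖ = t :=
    fun w => mem_sphere_zero_iff_norm.1 w.2
  have hv : ∀ k, ‖v k‖ ≤ t := by
    rintro (_ | k)
    · simpa [v] using ht0.le
    · exact (hu (u k)).le
  set M := 2 * t * (n * s) / α with hMdef
  have hM : 0 < M := by positivity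
  have hdev := measure_exists_deviation_le (n := n) β σ ε Q (v := v) rfl ht0.le hv hM
  rw [hsn] at hdev
  have hMα : 2 * t * (n * s) / M = α := by rw [hMdef]; field_simp
  rw [hMα] at hdev
  refine le_trans (measure_mono ?_) hdev
  rw [Set.compl_subset_comm]
  intro d hd
  simp only [Set.mem_compl_iff, Set.mem_ofPred_eq, not_exists, not_lt] at hd
  -- Mean growth minus the deviation allowed with probability `α`. The 6 is the 3 of
  -- `add_sq_div_le_sqrt` doubled by `1 - ε ≥ 1/2`; the radius makes `L` positive.
  set L := κ * t * (t / (6 * σ) - ε) - M / n with hL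
  have hLpos : 0 < L := by
    have e : L = κ * t * (s + 2 / (α * κ) * ε) := by
      have : t / (6 * σ) = (1 + 2 / (α * κ)) * (s + ε) := by
        rw [← ht]
        field_simp
      rw [hL, this, hMdef]
      field_simp
      ring
    rw [e]
    positivity
  have hmean : ∀ δ : EuclideanSpace ℝ (Fin p), ‖δ‖ = t →
      κ * t * (t / (6 * σ) - ε) ≤ ∫ z, excessLoss β δ z ∂(adaptiveLaw β σ ε Q) := by
    intro δ hδ
    refine le_trans ?_ (le_integral_excessLoss β σ ε Q hσ.le hε0 (by linarith) δ)
    rw [hδ, mul_assoc]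
    refine mul_le_mul_of_nonneg_left ?_ hκ.le
    have h1 := add_sq_div_le_sqrt hσ ht0.le htσ
    have h2 : t * (t / (6 * σ)) = 1 / 2 * (t ^ 2 / (3 * σ)) := by field_simp; ring
    have h3 : 0 ≤ t ^ 2 / (3 * σ) := by positivity
    have h4 : 1 / 2 * (t ^ 2 / (3 * σ)) ≤ (1 - ε) * (√(σ ^ 2 + t ^ 2) - σ) :=
      mul_le_mul (by linarith) (by linarith) h3 (by linarith)
    linarith
  have hdense : ∀ w : Metric.sphere (0 : EuclideanSpace ℝ (Fin p)) t,
      L ≤ absLoss d (β + w) - absLoss d β := by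
    intro w
    refine (TopologicalSpace.denseRange_denseSeq _).induction_on w ?_ fun k => ?_
    -- The fixed margin `L` survives the limit from the dense sequence; a bare strict inequality
    -- would not.
    · exact isClosed_le continuous_const
        (((continuous_absLoss d).comp (by fun_prop)).sub continuous_const)
    · have h1 := hd (k + 1)
      change ∑ i, (∫ z, excessLoss β (u k) z ∂_ - excessLoss β (u k) (d i)) ≤ M at h1
      rw [Finset.sum_sub_distrib, Finset.sum_const, Finset.card_univ, Fintype.card_fin,
        nsmul_eq_mul] at h1
      have h2 := hmean (u k) (hu (u k))
      change L ≤ absLoss d (β + u k) - absLoss d β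
      rw [absLoss_sub_eq]
      have h3 : M / n = 1 / n * M := by ring
      have h4 := mul_le_mul_of_nonneg_left h1 (by positivity : 0 ≤ 1 / (n : ℝ))
      rw [mul_sub, ← mul_assoc, one_div_mul_cancel hn'.ne', one_mul, ← h3] at h4
      linarith
  intro δ hδ
  have := hdense ⟨δ, mem_sphere_zero_iff_norm.2 hδ⟩
  simp only at this
  linarith

end MedianRegression

theorem theorem4p2 (α : ℝ) (hα0 : 0 < α) (hα1 : α < 1) :
    ∃ C c : ℝ, 0 < C ∧ 0 < c ∧
      ∀ (n p : ℕ) (_ : 0 < n) (β : EuclideanSpace ℝ (Fin p)) (σ ε : ℝ) (_ : 0 < σ)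
        (_ : 0 ≤ ε) (_ : ε ≤ 1)
        (Q : Kernel (EuclideanSpace ℝ (Fin p)) ℝ) (_ : IsMarkovKernel Q),
        Real.sqrt ((p : ℝ) / (n : ℝ)) + ε ≤ c →
          1 - α ≤ (adaptiveSampleLaw n β σ ε Q).real
            {d | (∃ b, IsMedianRegression d b) ∧
              ∀ b, IsMedianRegression d b →
                ‖b - β‖ ≤ C * σ * (Real.sqrt ((p : ℝ) / (n : ℝ)) + ε)} := by
  have hκ := gaussianAbsMean_pos
  set C := 6 * (1 + 2 / (α * gaussianAbsMean)) with hC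
  have hC6 : 6 ≤ C := by
    have : 0 < 2 / (α * gaussianAbsMean) := by positivity
    linarith
  have hC0 : 0 < C := by linarith
  -- The bound `C * r ≤ 1` keeps the radius at most `σ` and, since `C ≥ 6`, forces `ε ≤ 1/2`.
  refine ⟨C, 1 / C, hC0, by positivity, ?_⟩
  intro n p hn β σ ε hσ hε0 hε1 Q hQ hr
  have hprob := isProbabilityMeasure_adaptiveSampleLaw n β σ ε hε0 hε1 Q
  set r := √((p : ℝ) / n) + ε with hrdef
  -- For `p = 0` the parameter space is one point, and the radius may vanish.
  rcases Nat.eq_zero_or_pos p with rfl | hp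
  · have huniv : {d : Fin n → EuclideanSpace ℝ (Fin 0) × ℝ | (∃ b, IsMedianRegression d b) ∧
        ∀ b, IsMedianRegression d b → ‖b - β‖ ≤ C * σ * r} = Set.univ := by
      refine Set.eq_univ_of_forall fun d => ⟨⟨0, fun b' => ?_⟩, fun b _ => ?_⟩
      · rw [Subsingleton.elim b' 0]
      · rw [Subsingleton.elim b β, sub_self, norm_zero]
        positivity
    rw [huniv, probReal_univ]
    linarith
  · have hs0 : 0 < √((p : ℝ) / n) := Real.sqrt_pos.2 (by positivity)
    have hr0 : 0 < r := by linarith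
    have hCr : C * r ≤ 1 := by
      have := mul_le_mul_of_nonneg_left hr hC0.le
      rwa [mul_one_div_cancel hC0.ne'] at this
    have hbad := measure_compl_sphere_separated_le hα0 hn hp β hσ hε0 (by nlinarith) Q
      (t := C * σ * r) (by nlinarith) rfl
    set A := {d : Fin n → EuclideanSpace ℝ (Fin p) × ℝ | ∀ δ : EuclideanSpace ℝ (Fin p),
      ‖δ‖ = C * σ * r → absLoss d β < absLoss d (β + δ)}
    have hA : (adaptiveSampleLaw n β σ ε Q).real Aᶜ ≤ α :=
      ENNReal.toReal_le_of_le_ofReal hα0.le hbad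
    -- Subadditivity suffices, so `A` need not be shown measurable.
    have hone : 1 ≤ (adaptiveSampleLaw n β σ ε Q).real A
        + (adaptiveSampleLaw n β σ ε Q).real Aᶜ := by
      have h := measureReal_union_le (μ := adaptiveSampleLaw n β σ ε Q) A Aᶜ
      rwa [Set.union_compl_self, probReal_univ] at h
    have hsub := measureReal_mono (μ := adaptiveSampleLaw n β σ ε Q) (s₁ := A)
      fun d hd => medianRegression_localized d β (by positivity : 0 < C * σ * r) hd
    exact le_trans (by linarith) hsub
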